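/- Let $r_0>0$ and let $D=\{x\in\mathbb R^2:\ |x|\le r_0\}$. For every $j\ge 1$ let $\psi_j:\mathbb R\to\mathbb R$ be Lipschitz continuous and $2\pi$-periodic, let $\rho_j>0$, and let $\Phi_j=(\Phi_j^x,\Phi_j^y)$ be the corresponding partial map of the harmonic transformation of $D$: each component is continuous on $D$, harmonic in the interior of $D$, and on $\partial D$ $$\Phi_j^x(r_0\cos\theta,r_0\sin\theta)=\cos(\theta)\,\psi_j(\theta),\qquad \Phi_j^y(r_0\cos\theta,r_0\sin\theta)=\sin(\theta)\,\psi_j(\theta).$$ Set $$b_j(x):=|\Phi_j(x)|+\sqrt2\,|\mathrm D_x\Phi_j(x)|_{2,2},\qquad x\in D,$$ where $|\cdot|$ is the Euclidean norm and $|\cdot|_{2,2}$ the spectral norm; at a boundary point, $\mathrm D_x\Phi_j(x)$ is the derivative relative to $D$ if it exists, and $0$ otherwise. For a real square-integrable $2\pi$-periodic function $f$ with Fourier coefficients $\hat f(n)=\frac1{2\pi}\int_0^{2\pi}f(\theta)e^{-in\theta}\,d\theta$, let $\mathcal H(f)$ be its periodic Hilbert transform, i.e. the $L^2$ function with Fourier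 coefficients $-i\,\mathrm{sign}(n)\hat f(n)$ (where $\mathrm{sign}(0)=0$), and let $A(f)(\theta):=|f(\theta)+i\mathcal H(f)(\theta)|$ be the instantaneous amplitude of $f$ (the modulus of its analytic signal), which is defined for almost every $\theta$. Then, as an inequality in $[0,\infty]$, $$\sup_{x\in D}\sum_{j\ge1}\rho_j b_j(x)\ \le\ \operatorname*{ess\,sup}_{\theta\in[0,2\pi)}\Big(\big(4\sqrt2\max\{1,r_0^{-1}\}+1\big)\sum_{j\ge1}\rho_jA(\psi_j)(\theta)+4\sqrt2\max\{1,r_0^{-1}\}\sum_{j\ge1}\rho_jA(\psi_j')(\theta)\Big).$$ In particular, the left-hand side is finite whenever the right-hand side is. -/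

import Mathlib

open Real MeasureTheory

namespace HarmonicMapping

/-- The plane `ℝ²` with the Euclidean norm. -/
abbrev Plane : Type := EuclideanSpace ℝ (Fin 2)

/-- The circle `ℝ / 2πℤ`, identified with `[0, 2π)`. -/
abbrev Circle2Pi : Type := AddCircle (2 * π)

instance factTwoPiPos : Fact (0 < 2 * π) := ⟨Real.two_pi_pos⟩

/-- The closed reference disc `D = {x ∈ ℝ² : |x| ≤ r₀}`. -/
def disc (r₀ : ℝ) : Set Plane := Metric.closedBall 0 r₀

/-- The Dirichlet problem on the disc of radius `r₀`: `u` is continuous on the closed disc,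
harmonic in its interior, and equals `φ(θ)` at the boundary point of angle `θ`. -/
structure SolvesDirichlet (r₀ : ℝ) (φ : ℝ → ℝ) (u : Plane → ℝ) : Prop where
  continuousOn : ContinuousOn u (disc r₀)
  harmonic : InnerProductSpace.HarmonicOnNhd u (interior (disc r₀))
  boundary : ∀ θ : ℝ, u !₂[r₀ * cos θ, r₀ * sin θ] = φ θ

/-- `Φ = (Φˣ, Φʸ)` is the partial map of the harmonic transformation belonging to the radial
perturbation `ψ`: its components are the harmonic extensions of `cos θ · ψ(θ)` and
`sin θ · ψ(θ)`. -/
structure IsHarmonicPartialMap (r₀ : ℝ) (ψ : ℝ → ℝ) (Φ : Plane → Plane) : Prop where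
  fst : SolvesDirichlet r₀ (fun θ => cos θ * ψ θ) (fun x => Φ x 0)
  snd : SolvesDirichlet r₀ (fun θ => sin θ * ψ θ) (fun x => Φ x 1)

/-- `b(x) = |Φ(x)| + √2 |DΦ(x)|₂,₂`, with the Euclidean norm and the spectral norm of the
Jacobian (the operator norm with respect to Euclidean norms). At interior points of the disc the
derivative within the disc is the usual derivative. -/
noncomputable def b (r₀ : ℝ) (Φ : Plane → Plane) (x : Plane) : ℝ :=
  ‖Φ x‖ + √2 * ‖fderivWithin ℝ Φ (disc r₀) x‖

/-- The Hilbert transform on the circle, as the Fourier multiplier on `L²` with symbol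
`-i sign(n)`. -/
noncomputable def hilbertTransform (f : Circle2Pi → ℂ) :
    Lp ℂ 2 (AddCircle.haarAddCircle (T := 2 * π)) :=
  ∑' n : ℤ, (-Complex.I * (n.sign : ℂ) * fourierCoeff f n) • fourierLp 2 n

/-- The analytic signal `f + i H(f)`, defined almost everywhere. -/
noncomputable def analyticSignal (f : Circle2Pi → ℂ) (θ : Circle2Pi) : ℂ :=
  f θ + Complex.I * hilbertTransform f θ

/-- The instantaneous amplitude `A(f) = |f + i H(f)|` of a real `2π`-periodic signal, which
is transported to the circle through its values on `[0, 2π)`. -/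
noncomputable def amplitude (f : ℝ → ℝ) (θ : Circle2Pi) : ℝ :=
  ‖analyticSignal (AddCircle.liftIco (2 * π) 0 (fun t => (f t : ℂ))) θ‖

end HarmonicMapping

/-!
Identify the disc of radius `r₀` with the unit disc of `ℂ`, and let `ψ` be one of the signals, with
Fourier coefficients `cₙ` and analytic signal `h = ψ + i H(ψ)`, whose coefficients are
`(1 + sign n) cₙ`; let `h'` be the analytic signal of `ψ'`. The partial map becomes the harmonic
extension `u` of `e^{iθ} ψ(θ)`, so that `u(w) = p(w) + q(w̄)` with
`p(w) = ∑_{n ≥ 0} c_{n-1} wⁿ` and `q(w̄) = ∑_{n ≥ 1} c_{-n-1} w̄ⁿ`, and the spectral norm of `Du` is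
at most `|p'(w)| + |q'(w̄)|`.

As `ψ` is real, `c_{-n}` is the conjugate of `cₙ`. Hence `p'` and the conjugate of `q'(w̄)` are the
holomorphic functions `∑ (n + 1) cₙ wⁿ` and `∑ (n + 1) c_{n+2} wⁿ`, with boundary values
`h' / (2i) + (h + c₀) / 2` and `e^{-2iθ} (h' / (2i) - (h - c₀) / 2)`. Both are the Poisson integrals
of their boundary values, which are bounded by `(A(ψ') + A(ψ) + |c₀|) / 2`; moreover `|c₀|` is at
most the mean of `A(ψ)`. With `P_w` the harmonic measure at `w` this gives
`|Du(w)| ≤ ∫ (A(ψ) + A(ψ')) dP_w + ∫ A(ψ) dθ / 2π` (`norm_fderiv_le_integral_amplitude`), and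
`|u(w)| ≤ ∫ A(ψ) dP_w` because `|ψ| ≤ A(ψ)` (`norm_le_integral_circlePoisson_amplitude`).

These bounds are integrals against measures that do not depend on `j`, so they can be summed over
`j` under the integral sign. The result is one integral against `P_w` and one against the normalised
arc length; the constants of the theorem are large enough for each of the two integrands to be at
most half of the essential supremum (`tsum_b_le_of_ae_le`).

At a boundary point `x` the derivative term counts only if the partial map is differentiable there
relative to the disc. Then the derivatives at `t x` converge to it as `t → 1`, by a gradient
estimate for the remainder of the first-order expansion (`tendsto_fderiv_radial`). The bound
therefore passes to `x` for every finite partial sum (`tsum_b_le_of_forall_interior`).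
-/

namespace HarmonicMapping

open scoped ENNReal NNReal ComplexConjugate

/-- The normalised Haar measure of the circle. -/
local notation "μ₀" => (AddCircle.haarAddCircle (T := 2 * π))

/-! ### Fourier coefficients of analytic signals and derivatives -/

section FourierCoefficients

open AddCircle

theorem fourierCoeff_fourier_mul (k n : ℤ) (f : Circle2Pi → ℂ) :
    fourierCoeff (fun t => fourier k t * f t) n = fourierCoeff f (n - k) := by
  have h : -(n - k) = -n + k := by ring
  simp only [fourierCoeff, smul_eq_mul, ← mul_assoc, ← fourier_add, h]

theorem fourierCoeff_conj (f : Circle2Pi → ℂ) (n : ℤ) :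
    fourierCoeff (fun t => (starRingEnd ℂ) (f t)) n = (starRingEnd ℂ) (fourierCoeff f (-n)) := by
  rw [fourierCoeff, fourierCoeff, ← integral_conj]
  congr! 2 with t
  simp

theorem ae_eq_of_fourierCoeff_eq {f g : Circle2Pi → ℂ} (hf : MemLp f 2 μ₀) (hg : MemLp g 2 μ₀)
    (h : fourierCoeff f = fourierCoeff g) : f =ᵐ[μ₀] g := by
  have : hf.toLp f = hg.toLp g := by
    apply fourierBasis.repr.injective
    ext n
    rw [fourierBasis_repr, fourierBasis_repr, fourierCoeff_congr_ae hf.coeFn_toLp,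
      fourierCoeff_congr_ae hg.coeFn_toLp, h]
  exact hf.coeFn_toLp.symm.trans (this ▸ hg.coeFn_toLp)

/-- The symbol of the Hilbert transform is bounded, so the defining series converges in `L²` and is
not a junk value. -/
theorem fourierCoeff_hilbertTransform {f : Circle2Pi → ℂ} (hf : MemLp f 2 μ₀) (n : ℤ) :
    fourierCoeff (hilbertTransform f) n = -Complex.I * (n.sign : ℂ) * fourierCoeff f n := by
  have hc : Memℓp (fun n : ℤ => -Complex.I * (n.sign : ℂ) * fourierCoeff f n) 2 := by
    have h0 := lp.memℓp (fourierBasis.repr (hf.toLp f))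
    have h1 : Memℓp (fun n => fourierCoeff f n) 2 := by
      have h2 : (fun n => fourierCoeff f n) = ⇑(fourierBasis.repr (hf.toLp f)) := by
        ext n
        rw [fourierBasis_repr, fourierCoeff_congr_ae hf.coeFn_toLp]
      exact h2 ▸ h0
    rw [memℓp_gen_iff (by simp)] at h1 ⊢
    refine h1.of_nonneg_of_le (fun _ => by positivity) fun n => ?_
    gcongr
    rw [norm_mul, norm_mul]
    have : ‖((n.sign : ℤ) : ℂ)‖ ≤ 1 := by
      rcases lt_trichotomy n 0 with h | h | h <;> simp [h, Int.sign_eq_neg_one_of_neg,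
        Int.sign_eq_one_of_pos]
    calc _ ≤ 1 * 1 * ‖fourierCoeff f n‖ := by gcongr; simp
      _ = _ := by ring
  have h2 := (fourierBasis (T := 2 * π)).hasSum_repr_symm (⟨_, hc⟩ : lp (fun _ : ℤ => ℂ) 2)
  simp only [coe_fourierBasis] at h2
  have h3 : hilbertTransform f = fourierBasis.repr.symm ⟨_, hc⟩ := h2.tsum_eq
  rw [← fourierBasis_repr, h3, LinearIsometryEquiv.apply_symm_apply]

theorem memLp_analyticSignal {f : Circle2Pi → ℂ} (hf : MemLp f 2 μ₀) :
    MemLp (analyticSignal f) 2 μ₀ :=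
  hf.add ((Lp.memLp (hilbertTransform f)).const_mul Complex.I)

theorem fourierCoeff_analyticSignal {f : Circle2Pi → ℂ} (hf : MemLp f 2 μ₀) (n : ℤ) :
    fourierCoeff (analyticSignal f) n = (1 + (n.sign : ℂ)) * fourierCoeff f n := by
  have h2 := (Lp.memLp (hilbertTransform f)).const_mul Complex.I
  have : analyticSignal f = f + fun θ => Complex.I * hilbertTransform f θ := rfl
  rw [this, fourierCoeff.add (hf.integrable (by norm_num)) (h2.integrable (by norm_num)),
    Pi.add_apply, fourierCoeff.const_mul, fourierCoeff_hilbertTransform hf]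
  linear_combination (-(n.sign : ℂ) * fourierCoeff f n) * Complex.I_sq

/-- The Hilbert transform of a real signal is real, so the signal is dominated by its
instantaneous amplitude. -/
theorem ae_norm_le_norm_analyticSignal {f : Circle2Pi → ℂ} (hf : MemLp f 2 μ₀)
    (hreal : ∀ t, (starRingEnd ℂ) (f t) = f t) :
    ∀ᵐ t ∂μ₀, ‖f t‖ ≤ ‖analyticSignal f t‖ := by
  have hh := memLp_analyticSignal hf
  have hc : MemLp (fun t => (starRingEnd ℂ) (analyticSignal f t)) 2 μ₀ := hh.star
  have key : (fun t => 2 * f t) =ᵐ[μ₀]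
      (analyticSignal f + fun t => (starRingEnd ℂ) (analyticSignal f t)) := by
    refine ae_eq_of_fourierCoeff_eq (hf.const_mul 2) (hh.add hc) (funext fun n => ?_)
    have hsym : (starRingEnd ℂ) (fourierCoeff f (-n)) = fourierCoeff f n := by
      rw [← fourierCoeff_conj]; simp only [hreal]
    rw [fourierCoeff.const_mul, fourierCoeff.add (hh.integrable (by norm_num))
      (hc.integrable (by norm_num)), Pi.add_apply, fourierCoeff_conj,
      fourierCoeff_analyticSignal hf, fourierCoeff_analyticSignal hf, map_mul, hsym]
    simp
    ring
  filter_upwards [key] with t ht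
  have h1 : ‖2 * f t‖ ≤ ‖analyticSignal f t‖ + ‖analyticSignal f t‖ := by
    rw [ht]
    refine (norm_add_le _ _).trans ?_
    simp
  rw [norm_mul] at h1
  norm_num at h1
  linarith

/-- A function on the line, transported to the circle through its values on `[0, 2π)`. -/
noncomputable abbrev circleLift (f : ℝ → ℝ) : Circle2Pi → ℂ :=
  AddCircle.liftIco (2 * π) 0 (fun t => (f t : ℂ))

theorem circleLift_eq (f : ℝ → ℝ) (t : Circle2Pi) :
    circleLift f t = (f (AddCircle.equivIco (2 * π) 0 t) : ℂ) := rfl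

theorem circleLift_coe {f : ℝ → ℝ} (hf : Function.Periodic f (2 * π)) (x : ℝ) :
    circleLift f (x : Circle2Pi) = (f x : ℂ) := by
  rw [circleLift_eq]
  simp only [AddCircle.equivIco, QuotientAddGroup.equivIcoMod_coe, toIcoMod]
  rw [hf.sub_zsmul_eq]

theorem conj_circleLift (f : ℝ → ℝ) (t : Circle2Pi) :
    (starRingEnd ℂ) (circleLift f t) = circleLift f t := by
  rw [circleLift_eq, Complex.conj_ofReal]

theorem memLp_circleLift {f : ℝ → ℝ} (hf : Measurable f) {C : ℝ}
    (hC : ∀ x ∈ Set.Ico 0 (2 * π), ‖f x‖ ≤ C) : MemLp (circleLift f) 2 μ₀ := by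
  have hm : Measurable (circleLift f) :=
    Complex.measurable_ofReal.comp
      (hf.comp (measurable_subtype_coe.comp (AddCircle.measurableEquivIco (2 * π) 0).measurable))
  refine MemLp.of_bound hm.aestronglyMeasurable C (ae_of_all _ fun t => ?_)
  rw [circleLift_eq, Complex.norm_real]
  have := (AddCircle.equivIco (2 * π) 0 t).2
  simp only [zero_add] at this
  exact hC _ this

theorem fourierCoeff_circleLift (f : ℝ → ℝ) (n : ℤ) :
    fourierCoeff (circleLift f) n = (1 / (2 * π) : ℝ) •
      ∫ x in (0 : ℝ)..2 * π, Complex.exp (-(n * x * Complex.I)) * f x := by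
  rw [fourierCoeff_eq_intervalIntegral _ n 0, zero_add]
  congr 1
  refine intervalIntegral.integral_congr_Ioo_of_le Real.two_pi_pos.le fun x hx => ?_
  rw [circleLift, AddCircle.liftIco_coe_apply (by simpa using ⟨hx.1.le, hx.2⟩), smul_eq_mul,
    fourier_coe_apply]
  congr 2
  push_cast
  have : (π : ℂ) ≠ 0 := by exact_mod_cast Real.pi_ne_zero
  field_simp

theorem memLp_circleLift_of_lipschitz {f : ℝ → ℝ} {K : ℝ≥0} (hf : LipschitzWith K f) :
    MemLp (circleLift f) 2 μ₀ := by
  obtain ⟨C, hC⟩ := (isCompact_Icc (a := (0 : ℝ)) (b := 2 * π)).exists_bound_of_continuousOn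
    hf.continuous.continuousOn
  exact memLp_circleLift hf.continuous.measurable fun x hx => hC x ⟨hx.1, hx.2.le⟩

theorem memLp_circleLift_deriv_of_lipschitz {f : ℝ → ℝ} {K : ℝ≥0} (hf : LipschitzWith K f) :
    MemLp (circleLift (deriv f)) 2 μ₀ :=
  memLp_circleLift (measurable_deriv f) fun _ _ => norm_deriv_le_of_lipschitz hf

/-- Integration by parts: differentiation multiplies the `n`-th Fourier coefficient of a
Lipschitz periodic function by `i n`. -/
theorem fourierCoeff_circleLift_deriv {f : ℝ → ℝ} {K : ℝ≥0} (hf : LipschitzWith K f)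
    (hper : Function.Periodic f (2 * π)) (n : ℤ) :
    fourierCoeff (circleLift (deriv f)) n = Complex.I * n * fourierCoeff (circleLift f) n := by
  have hfac : AbsolutelyContinuousOnInterval f 0 (2 * π) :=
    (hf.lipschitzOnWith).absolutelyContinuousOnInterval
  have hfp : f (2 * π) = f 0 := by simpa using hper 0
  have hdi : IntervalIntegrable (deriv f) volume 0 (2 * π) := hfac.intervalIntegrable_deriv
  have hcc : ContDiff ℝ 1 (fun x : ℝ => cos (n * x)) := by fun_prop
  have hcs : ContDiff ℝ 1 (fun x : ℝ => sin (n * x)) := by fun_prop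
  have acc : AbsolutelyContinuousOnInterval (fun x : ℝ => cos (n * x)) 0 (2 * π) := by
    obtain ⟨K', hK'⟩ := hcc.contDiffOn.exists_lipschitzOnWith one_ne_zero
      (convex_uIcc 0 (2 * π)) isCompact_uIcc
    exact hK'.absolutelyContinuousOnInterval
  have acs : AbsolutelyContinuousOnInterval (fun x : ℝ => sin (n * x)) 0 (2 * π) := by
    obtain ⟨K', hK'⟩ := hcs.contDiffOn.exists_lipschitzOnWith one_ne_zero
      (convex_uIcc 0 (2 * π)) isCompact_uIcc
    exact hK'.absolutelyContinuousOnInterval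
  have dc : ∀ x : ℝ, deriv (fun x : ℝ => cos (n * x)) x = -(n * sin (n * x)) := fun x => by
    have := ((hasDerivAt_id' x).const_mul (n : ℝ)).cos.deriv; rw [this]; ring
  have ds : ∀ x : ℝ, deriv (fun x : ℝ => sin (n * x)) x = n * cos (n * x) := fun x => by
    have := ((hasDerivAt_id' x).const_mul (n : ℝ)).sin.deriv; rw [this]; ring
  have e1 := acc.integral_mul_deriv_eq_deriv_mul hfac
  have e2 := acs.integral_mul_deriv_eq_deriv_mul hfac
  have c2 : cos (n * (2 * π)) = 1 := Real.cos_int_mul_two_pi n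
  have s2 : sin (n * (2 * π)) = 0 := by
    have := Real.sin_int_mul_pi (n * 2); push_cast at this; rw [← this]; ring_nf
  simp only [dc, ds, hfp, c2, s2, mul_zero, cos_zero, sin_zero, one_mul, zero_mul, sub_self,
    zero_sub, neg_mul, intervalIntegral.integral_neg, neg_neg, mul_assoc,
    intervalIntegral.integral_const_mul] at e1 e2
  -- Integration by parts is used for the real and imaginary parts of the exponential.
  have split : ∀ g : ℝ → ℝ, IntervalIntegrable g volume 0 (2 * π) →
      ∫ x in (0 : ℝ)..2 * π, Complex.exp (-(n * x * Complex.I)) * g x =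
        ((∫ x in (0 : ℝ)..2 * π, cos (n * x) * g x : ℝ) : ℂ) -
        Complex.I * ((∫ x in (0 : ℝ)..2 * π, sin (n * x) * g x : ℝ) : ℂ) := by
    intro g hg
    rw [← intervalIntegral.integral_ofReal, ← intervalIntegral.integral_ofReal,
      ← intervalIntegral.integral_const_mul, ← intervalIntegral.integral_sub]
    · congr with x
      rw [← neg_mul, Complex.exp_mul_I]
      push_cast
      simp
      ring
    · have h := hg.continuousOn_mul hcc.continuous.continuousOn
      exact ⟨h.1.ofReal, h.2.ofReal⟩
    · have h := hg.continuousOn_mul hcs.continuous.continuousOn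
      exact IntervalIntegrable.const_mul ⟨h.1.ofReal, h.2.ofReal⟩ _
  rw [fourierCoeff_circleLift, fourierCoeff_circleLift, split _ hdi,
    split _ (hf.continuous.intervalIntegrable _ _), e1, e2]
  simp only [Complex.real_smul]
  push_cast
  linear_combination ((1 / (2 * π : ℂ)) * n *
    ((∫ x in (0 : ℝ)..2 * π, sin (n * x) * f x : ℝ) : ℂ)) * Complex.I_sq

end FourierCoefficients

/-! ### The Poisson kernel on the circle -/

section PoissonKernel

open AddCircle

/-- The Poisson kernel of the unit disc at `w`, as a density on the circle `ℝ / 2πℤ`. -/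
noncomputable def circlePoisson (w : ℂ) (t : Circle2Pi) : ℝ :=
  poissonKernel 0 w (toCircle t)

theorem norm_sub_pos_of_norm_lt_one {w z : ℂ} (hw : ‖w‖ < 1) (hz : ‖z‖ = 1) : 0 < ‖z - w‖ := by
  rw [norm_pos_iff, sub_ne_zero]
  rintro rfl
  exact hw.ne hz

theorem continuous_circlePoisson {w : ℂ} (hw : ‖w‖ < 1) : Continuous (circlePoisson w) := by
  have hc : Continuous fun t : Circle2Pi => (toCircle t : ℂ) :=
    continuous_subtype_val.comp continuous_toCircle
  have h0 : ∀ t : Circle2Pi, ‖(toCircle t : ℂ) - 0 - (w - 0)‖ ^ 2 ≠ 0 := fun t => by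
    have := norm_sub_pos_of_norm_lt_one hw (Circle.norm_coe (toCircle t))
    rw [sub_zero, sub_zero]
    positivity
  unfold circlePoisson poissonKernel
  fun_prop (disch := exact h0 _)

theorem circlePoisson_nonneg {w : ℂ} (hw : ‖w‖ < 1) (t : Circle2Pi) : 0 ≤ circlePoisson w t := by
  unfold circlePoisson poissonKernel
  rw [sub_zero, sub_zero, Circle.norm_coe]
  have : ‖w‖ ^ 2 ≤ 1 := pow_le_one₀ (norm_nonneg _) hw.le
  apply div_nonneg <;> nlinarith [norm_nonneg ((toCircle t : ℂ) - w)]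

/-- The two geometric series of the Poisson kernel. -/
theorem hasSum_circlePoisson {w : ℂ} (hw : ‖w‖ < 1) (t : Circle2Pi) :
    HasSum (fun n : ℕ => w ^ n * fourier (-(n : ℤ)) t +
      conj w ^ (n + 1) * fourier ((n : ℤ) + 1) t) (circlePoisson w t : ℂ) := by
  set z : ℂ := ((toCircle t : Circle) : ℂ) with hz
  have hz1 : ‖z‖ = 1 := Circle.norm_coe _
  have hzz : z * conj z = 1 := by rw [Complex.mul_conj, Complex.normSq_eq_norm_sq, hz1]; simp
  have hpow : ∀ n : ℕ, (fourier (n : ℤ) t : ℂ) = z ^ n := fun n => by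
    rw [fourier_apply, natCast_zsmul, toCircle_nsmul, Circle.coe_pow]
  have hn1 : ‖w * conj z‖ < 1 := by rw [norm_mul, RCLike.norm_conj, hz1, mul_one]; exact hw
  have hn2 : ‖conj w * z‖ < 1 := by rw [norm_mul, RCLike.norm_conj, hz1, mul_one]; exact hw
  have h1 := hasSum_geometric_of_norm_lt_one hn1
  have h2 := (hasSum_geometric_of_norm_lt_one hn2).mul_left (conj w * z)
  have d1 : (1 - w * conj z) ≠ 0 := sub_ne_zero.2 fun h => by rw [← h] at hn1; simp at hn1
  have d2 : (1 - conj w * z) ≠ 0 := sub_ne_zero.2 fun h => by rw [← h] at hn2; simp at hn2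
  have hP : (circlePoisson w t : ℂ) = (1 - w * conj w) / ((1 - w * conj z) * (1 - conj w * z)) := by
    unfold circlePoisson poissonKernel
    rw [sub_zero, sub_zero, ← hz, hz1]
    push_cast
    rw [← Complex.mul_conj', ← Complex.mul_conj', map_sub]
    congr 1
    · ring
    · linear_combination (1 - w * conj w) * hzz
  have hA : (fun n : ℕ => w ^ n * fourier (-(n : ℤ)) t +
      conj w ^ (n + 1) * fourier ((n : ℤ) + 1) t) =
      fun n : ℕ => (w * conj z) ^ n + conj w * z * (conj w * z) ^ n := by
    funext n
    rw [fourier_neg, show (n : ℤ) + 1 = ((n + 1 : ℕ) : ℤ) by push_cast; rfl, hpow, hpow, map_pow]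
    ring
  have hB : (circlePoisson w t : ℂ) =
      (1 - w * conj z)⁻¹ + conj w * z * (1 - conj w * z)⁻¹ := by
    rw [hP]
    field_simp
    linear_combination (w * conj w) * hzz
  rw [hA, hB]
  exact h1.add h2

/-- The Poisson integral of an integrable function in terms of its Fourier coefficients. -/
theorem hasSum_integral_circlePoisson {w : ℂ} (hw : ‖w‖ < 1) {f : Circle2Pi → ℂ}
    (hf : Integrable f μ₀) :
    HasSum (fun n : ℕ => w ^ n * fourierCoeff f n + conj w ^ (n + 1) * fourierCoeff f (-(n + 1)))
      (∫ t, (circlePoisson w t : ℂ) * f t ∂μ₀) := by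
  set F : ℕ → Circle2Pi → ℂ := fun n t => w ^ n * (fourier (-(n : ℤ)) t • f t) +
      conj w ^ (n + 1) * (fourier ((n : ℤ) + 1) t • f t) with hF
  have i1 : ∀ n : ℕ, Integrable (fun t => w ^ n * (fourier (-(n : ℤ)) t • f t)) μ₀ :=
    fun n => (hf.fourier_smul _).const_mul _
  have i2 : ∀ n : ℕ, Integrable (fun t => conj w ^ (n + 1) * (fourier ((n : ℤ) + 1) t • f t)) μ₀ :=
    fun n => (hf.fourier_smul _).const_mul _
  have hint : ∀ n, Integrable (F n) μ₀ := fun n => (i1 n).add (i2 n)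
  have hone : ∀ (k : ℤ) (t : Circle2Pi), ‖(fourier k t : ℂ)‖ = 1 := fun k t => by
    rw [fourier_apply]; exact Circle.norm_coe _
  have hbd : ∀ n t, ‖F n t‖ ≤ 2 * ‖w‖ ^ n * ‖f t‖ := fun n t => by
    refine (norm_add_le _ _).trans ?_
    rw [norm_mul, norm_mul, norm_smul, norm_smul, hone, hone, norm_pow, norm_pow, RCLike.norm_conj]
    have : ‖w‖ ^ (n + 1) ≤ ‖w‖ ^ n := pow_le_pow_of_le_one (norm_nonneg _) hw.le (Nat.le_succ n)
    nlinarith [norm_nonneg (f t)]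
  have hsum : Summable fun n => ∫ t, ‖F n t‖ ∂μ₀ := by
    refine Summable.of_nonneg_of_le (fun n => integral_nonneg fun _ => norm_nonneg _)
      (fun n => integral_mono (hint n).norm (hf.norm.const_mul _) (hbd n)) ?_
    simp only [integral_const_mul]
    exact ((summable_geometric_of_lt_one (norm_nonneg _) hw).mul_left 2).mul_right _
  have key := hasSum_integral_of_summable_integral_norm hint hsum
  have hA : (fun n : ℕ => w ^ n * fourierCoeff f n + conj w ^ (n + 1) * fourierCoeff f (-(n + 1))) =
      fun n => ∫ t, F n t ∂μ₀ := by
    funext n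
    simp only [hF]
    rw [integral_add (i1 n) (i2 n), integral_const_mul, integral_const_mul, fourierCoeff,
      fourierCoeff, neg_neg]
  have hB : ∫ t, (circlePoisson w t : ℂ) * f t ∂μ₀ = ∫ t, ∑' n, F n t ∂μ₀ := by
    refine integral_congr_ae (ae_of_all _ fun t => ?_)
    have := (hasSum_circlePoisson hw t).mul_right (f t)
    change (circlePoisson w t : ℂ) * f t = ∑' n, F n t
    rw [← this.tsum_eq]
    refine tsum_congr fun n => ?_
    simp only [hF, smul_eq_mul]
    ring
  rw [hA, hB]
  exact key

theorem integral_circlePoisson {w : ℂ} (hw : ‖w‖ < 1) : ∫ t, circlePoisson w t ∂μ₀ = 1 := by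
  have h := hasSum_integral_circlePoisson hw (f := fourier (0 : ℤ))
    ((map_continuous (fourier 0)).integrable_of_hasCompactSupport
      (HasCompactSupport.of_compactSpace _))
  have h2 := hasSum_ite_eq (0 : ℕ) (1 : ℂ)
  have h3 : (fun n : ℕ => w ^ n * fourierCoeff (fourier (T := 2 * π) (0 : ℤ)) n +
      conj w ^ (n + 1) * fourierCoeff (fourier (T := 2 * π) (0 : ℤ)) (-(n + 1)))
      = fun n : ℕ => if n = 0 then (1 : ℂ) else 0 := by
    ext n
    rw [fourierCoeff_fourier]
    have : (-1 + -(n : ℤ)) ≠ 0 := by omega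
    rcases eq_or_ne n 0 with rfl | hn
    · simp
    · simp [hn, Pi.single_eq_of_ne this]
  rw [h3] at h
  have h4 := h.unique h2
  simp only [fourier_zero, mul_one] at h4
  exact Complex.ofReal_injective (integral_complex_ofReal.symm.trans (by simpa using h4))

theorem integrable_circlePoisson_mul {w : ℂ} (hw : ‖w‖ < 1) {E : Type*} [NormedAddCommGroup E]
    [NormedSpace ℝ E] {f : Circle2Pi → E} (hf : Integrable f μ₀) :
    Integrable (fun t => circlePoisson w t • f t) μ₀ := by
  obtain ⟨C, hC⟩ := isCompact_univ.exists_bound_of_continuousOn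
    (continuous_circlePoisson hw).continuousOn
  exact hf.bdd_smul C (continuous_circlePoisson hw).aestronglyMeasurable
    (ae_of_all _ fun t => hC t trivial)

/-- A power series whose coefficients are the Fourier coefficients of a boundary function of
Hardy type is bounded by the Poisson integral of the modulus of this function. -/
theorem norm_tsum_le_integral_circlePoisson {w : ℂ} (hw : ‖w‖ < 1) {f : Circle2Pi → ℂ}
    (hf : Integrable f μ₀) (hneg : ∀ n : ℤ, n < 0 → fourierCoeff f n = 0) :
    ‖∑' n : ℕ, fourierCoeff f n * w ^ n‖ ≤ ∫ t, circlePoisson w t * ‖f t‖ ∂μ₀ := by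
  have h := hasSum_integral_circlePoisson hw hf
  have h3 : (fun n : ℕ => w ^ n * fourierCoeff f n + conj w ^ (n + 1) * fourierCoeff f (-(n + 1)))
      = fun n : ℕ => fourierCoeff f n * w ^ n := by
    ext n
    rw [hneg (-((n : ℤ) + 1)) (by omega)]
    ring
  rw [h3] at h
  rw [h.tsum_eq]
  refine (norm_integral_le_integral_norm _).trans_eq (integral_congr_ae (ae_of_all _ fun t => ?_))
  simp [abs_of_nonneg (circlePoisson_nonneg hw t)]

/-- The **Poisson integral formula** for the unit disc, over `ℝ / 2πℤ`. -/
theorem eq_integral_circlePoisson_real {v : ℂ → ℝ}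
    (hv : InnerProductSpace.HarmonicContOnCl v (Metric.ball 0 1)) {w : ℂ} (hw : ‖w‖ < 1) :
    v w = ∫ t : Circle2Pi, circlePoisson w t * v (toCircle t) ∂μ₀ := by
  have h := hv.circleAverage_poissonKernel_smul (mem_ball_zero_iff.2 hw)
  rw [← h, Real.circleAverage, integral_haarAddCircle,
    ← AddCircle.intervalIntegral_preimage (2 * π) 0, zero_add]
  congr 1
  refine intervalIntegral.integral_congr fun x _ => ?_
  simp [circlePoisson, circleMap, AddCircle.toCircle_apply_mk]

theorem continuous_comp_toCircle {u : ℂ → ℂ} (hu : ContinuousOn u (Metric.closedBall 0 1)) :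
    Continuous fun t : Circle2Pi => u (toCircle t : Circle) :=
  hu.comp_continuous (continuous_subtype_val.comp continuous_toCircle) fun t => by
    rw [mem_closedBall_zero_iff, Circle.norm_coe]

/-- The **Poisson integral formula** for complex-valued functions. -/
theorem eq_integral_circlePoisson {u : ℂ → ℂ}
    (hu : InnerProductSpace.HarmonicContOnCl u (Metric.ball 0 1)) {w : ℂ} (hw : ‖w‖ < 1) :
    u w = ∫ t : Circle2Pi, (circlePoisson w t : ℂ) * u (toCircle t : Circle) ∂μ₀ := by
  have hi : Integrable (fun t : Circle2Pi => u (toCircle t : Circle)) μ₀ :=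
    (continuous_comp_toCircle hu.continuousOn_ball).integrable_of_hasCompactSupport
      (HasCompactSupport.of_compactSpace _)
  have hi2 := integrable_circlePoisson_mul hw hi
  simp only [Complex.real_smul] at hi2
  apply Complex.ext
  · rw [← Complex.reCLM_apply, ← Complex.reCLM_apply, ← Complex.reCLM.integral_comp_comm hi2]
    simpa using eq_integral_circlePoisson_real (hu.comp_CLM Complex.reCLM) hw
  · rw [← Complex.imCLM_apply, ← Complex.imCLM_apply, ← Complex.imCLM.integral_comp_comm hi2]
    simpa using eq_integral_circlePoisson_real (hu.comp_CLM Complex.imCLM) hw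

end PoissonKernel

/-! ### Power series of harmonic extensions -/

section PowerSeries

open AddCircle

theorem summable_mul_pow_of_bounded {a : ℕ → ℂ} {C : ℝ} (ha : ∀ n, ‖a n‖ ≤ C) {w : ℂ}
    (hw : ‖w‖ < 1) : Summable fun n => a n * w ^ n := by
  refine Summable.of_norm_bounded ((summable_geometric_of_lt_one (norm_nonneg w) hw).mul_left C)
    fun n => ?_
  rw [norm_mul, norm_pow]
  gcongr
  exact ha n

/-- Term-by-term differentiation of a power series with bounded coefficients in the unit disc. -/
theorem hasDerivAt_tsum_mul_pow {a : ℕ → ℂ} {C : ℝ} (ha : ∀ n, ‖a n‖ ≤ C) {w : ℂ}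
    (hw : ‖w‖ < 1) :
    HasDerivAt (fun z => ∑' n, a n * z ^ n) (∑' n : ℕ, ((n : ℂ) + 1) * a (n + 1) * w ^ n) w := by
  obtain ⟨r, hwr, hr1⟩ := exists_between hw
  have hr0 : 0 < r := (norm_nonneg w).trans_lt hwr
  have hC : 0 ≤ C := (norm_nonneg _).trans (ha 0)
  have hu : Summable fun n : ℕ => C / r * (n * r ^ n) := by
    have := summable_pow_mul_geometric_of_norm_lt_one 1 (r := r)
      (by rwa [Real.norm_of_nonneg hr0.le])
    simpa using this.mul_left (C / r)
  have hbd : ∀ n : ℕ, ∀ z ∈ Metric.ball (0 : ℂ) r,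
      ‖a n * (n * z ^ (n - 1))‖ ≤ C / r * (n * r ^ n) := fun n z hz => by
    rw [mem_ball_zero_iff] at hz
    rcases n with _ | n
    · simp
    · rw [norm_mul, norm_mul, norm_pow, Complex.norm_natCast, Nat.add_sub_cancel]
      calc _ ≤ C * (((n + 1 : ℕ) : ℝ) * r ^ n) := by
            gcongr
            exact ha _
        _ = _ := by rw [pow_succ]; field_simp
  have hwb : w ∈ Metric.ball (0 : ℂ) r := mem_ball_zero_iff.2 hwr
  have key := hasDerivAt_tsum_of_isPreconnected (𝕜 := ℂ)
    (g := fun n z => a n * z ^ n) (g' := fun n z => a n * (n * z ^ (n - 1))) hu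
    Metric.isOpen_ball (convex_ball 0 r).isPreconnected
    (fun n z _ => (hasDerivAt_pow n z).const_mul (a n)) hbd
    (Metric.mem_ball_self hr0) (summable_mul_pow_of_bounded ha (by simp)) hwb
  have hs : Summable fun n : ℕ => a n * (n * w ^ (n - 1)) :=
    Summable.of_norm_bounded hu fun n => hbd n w hwb
  have he : ∑' n : ℕ, a n * (n * w ^ (n - 1)) = ∑' n : ℕ, ((n : ℂ) + 1) * a (n + 1) * w ^ n := by
    rw [hs.tsum_eq_zero_add]
    simp only [Nat.cast_zero, zero_mul, mul_zero, zero_add, Nat.add_sub_cancel, Nat.cast_add,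
      Nat.cast_one]
    exact tsum_congr fun n => by ring
  rwa [he] at key

theorem norm_fourierCoeff_le {f : Circle2Pi → ℂ} (n : ℤ) :
    ‖fourierCoeff f n‖ ≤ ∫ t, ‖f t‖ ∂μ₀ := by
  refine (norm_integral_le_integral_norm _).trans_eq (integral_congr_ae (ae_of_all _ fun t => ?_))
  change ‖fourier (-n) t • f t‖ = ‖f t‖
  rw [norm_smul, fourier_apply, Circle.norm_coe, one_mul]

/-- A function of the form `p(z) + q(z̄)`, with `p` and `q` holomorphic, has a derivative whose
operator norm is at most `|p'| + |q'|`. -/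
theorem norm_fderiv_add_comp_conj_le {p q : ℂ → ℂ} {p' q' w : ℂ} (hp : HasDerivAt p p' w)
    (hq : HasDerivAt q q' (conj w)) :
    ‖fderiv ℝ (fun z => p z + q (conj z)) w‖ ≤ ‖p'‖ + ‖q'‖ := by
  have h1 := hp.hasFDerivAt.restrictScalars ℝ
  have h2 : HasFDerivAt (fun z => q (conj z)) _ w := HasFDerivAt.comp w
    (hq.hasFDerivAt.restrictScalars ℝ) (Complex.conjCLE : ℂ ≃L[ℝ] ℂ).hasFDerivAt
  rw [(h1.fun_add h2).fderiv]
  refine ContinuousLinearMap.opNorm_le_bound _ (by positivity) fun v => ?_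
  simp
  refine (norm_add_le _ _).trans_eq ?_
  simp
  ring

/-- The harmonic extension of a continuous boundary function is the sum of a power series in `w`
and one in `w̄`. -/
theorem eq_tsum_add_tsum_conj {u : ℂ → ℂ}
    (hu : InnerProductSpace.HarmonicContOnCl u (Metric.ball 0 1)) {w : ℂ} (hw : ‖w‖ < 1)
    {g : Circle2Pi → ℂ} (hg : ∀ t, u (toCircle t : Circle) = g t) :
    u w = ∑' n : ℕ, fourierCoeff g n * w ^ n +
      ∑' n : ℕ, (if n = 0 then 0 else fourierCoeff g (-n)) * conj w ^ n := by
  have hgc : Continuous g := by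
    simpa only [hg] using continuous_comp_toCircle hu.continuousOn_ball
  have hgi : Integrable g μ₀ :=
    hgc.integrable_of_hasCompactSupport (HasCompactSupport.of_compactSpace _)
  have h1 := eq_integral_circlePoisson hu hw
  simp only [hg] at h1
  rw [h1, ← (hasSum_integral_circlePoisson hw hgi).tsum_eq]
  have hb : ∀ n : ℤ, ‖fourierCoeff g n‖ ≤ ∫ t, ‖g t‖ ∂μ₀ := fun n => norm_fourierCoeff_le n
  have s1 := summable_mul_pow_of_bounded (a := fun n : ℕ => fourierCoeff g n)
    (fun n => hb n) hw
  have s2 := summable_mul_pow_of_bounded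
    (a := fun n : ℕ => if n = 0 then 0 else fourierCoeff g (-n)) (C := ∫ t, ‖g t‖ ∂μ₀)
    (fun n => by
      split_ifs
      · simpa using integral_nonneg fun t => norm_nonneg (g t)
      · exact hb _) (w := conj w) (by rwa [RCLike.norm_conj])
  have s3 := (summable_nat_add_iff 1).2 s2
  rw [s2.tsum_eq_zero_add]
  simp only [if_true, zero_mul, zero_add, Nat.add_eq_zero_iff, one_ne_zero, and_false, if_false]
    at s3 ⊢
  rw [← s1.tsum_add s3]
  refine tsum_congr fun n => ?_
  push_cast
  ring

end PowerSeries

/-! ### Bounds by Poisson integrals of amplitudes -/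

section InteriorBounds

open AddCircle

theorem amplitude_eq (f : ℝ → ℝ) (t : Circle2Pi) :
    amplitude f t = ‖analyticSignal (circleLift f) t‖ := rfl

theorem amplitude_nonneg (f : ℝ → ℝ) (t : Circle2Pi) : 0 ≤ amplitude f t := norm_nonneg _

theorem integrable_amplitude {f : ℝ → ℝ} (hf : MemLp (circleLift f) 2 μ₀) :
    Integrable (amplitude f) μ₀ :=
  ((memLp_analyticSignal hf).integrable (by norm_num)).norm

theorem integrable_circlePoisson_mul_amplitude {w : ℂ} (hw : ‖w‖ < 1) {f : ℝ → ℝ}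
    (hf : MemLp (circleLift f) 2 μ₀) :
    Integrable (fun t => circlePoisson w t * amplitude f t) μ₀ :=
  integrable_circlePoisson_mul hw (integrable_amplitude hf)

/-- The mean of a signal is the mean of its analytic signal. -/
theorem norm_fourierCoeff_zero_le {f : ℝ → ℝ} (hf : MemLp (circleLift f) 2 μ₀) :
    ‖fourierCoeff (circleLift f) 0‖ ≤ ∫ t, amplitude f t ∂μ₀ := by
  have h := fourierCoeff_analyticSignal hf 0
  simp only [Int.sign_zero, Int.cast_zero, add_zero, one_mul] at h
  rw [← h]
  exact norm_fourierCoeff_le 0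

/-- The harmonic extension of `e^{iθ} f(θ)` is dominated by the Poisson integral of the amplitude
of `f`. -/
theorem norm_le_integral_circlePoisson_amplitude {f : ℝ → ℝ} (hf : MemLp (circleLift f) 2 μ₀)
    {u : ℂ → ℂ} (hu : InnerProductSpace.HarmonicContOnCl u (Metric.ball 0 1))
    (hb : ∀ t, u (toCircle t : Circle) = fourier 1 t * circleLift f t) {w : ℂ} (hw : ‖w‖ < 1) :
    ‖u w‖ ≤ ∫ t, circlePoisson w t * amplitude f t ∂μ₀ := by
  have hn : ∀ t, ‖u (toCircle t : Circle)‖ = ‖circleLift f t‖ := fun t => by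
    rw [hb, norm_mul, fourier_apply, Circle.norm_coe, one_mul]
  rw [eq_integral_circlePoisson hu hw]
  refine (norm_integral_le_integral_norm _).trans (integral_mono_of_nonneg
    (ae_of_all _ fun t => norm_nonneg _) (integrable_circlePoisson_mul_amplitude hw hf) ?_)
  filter_upwards [ae_norm_le_norm_analyticSignal hf (conj_circleLift f)] with t ht
  rw [norm_mul, hn, Complex.norm_real, Real.norm_of_nonneg (circlePoisson_nonneg hw t)]
  exact mul_le_mul_of_nonneg_left ht (circlePoisson_nonneg hw t)

/-- With `h`, `h'` the analytic signals of `ψ`, `ψ'` and `c₀` the mean of `ψ`, this is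
`h' / (2i) + β h + c₀ / 2`. For `β = 1/2` it is the boundary function of `∂u`, and for
`β = -1/2`, after multiplication by `e^{-2iθ}`, that of the conjugate of `∂̄u`, where `u` is the
harmonic extension of `e^{iθ} ψ(θ)`. -/
noncomputable def derivativeSignal (ψ : ℝ → ℝ) (β : ℂ) (t : Circle2Pi) : ℂ :=
  -(Complex.I / 2) * analyticSignal (circleLift (deriv ψ)) t +
    β * analyticSignal (circleLift ψ) t +
    fourierCoeff (circleLift ψ) 0 / 2 * fourier 0 t

theorem norm_derivativeSignal_le (ψ : ℝ → ℝ) {β : ℂ} (hβ : ‖β‖ = 1 / 2) (t : Circle2Pi) :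
    ‖derivativeSignal ψ β t‖ ≤
      1 / 2 * (amplitude ψ t + amplitude (deriv ψ) t + ‖fourierCoeff (circleLift ψ) 0‖) := by
  refine (norm_add₃_le).trans_eq ?_
  rw [norm_mul, norm_mul, norm_mul, hβ, fourier_zero, ← amplitude_eq, ← amplitude_eq]
  simp
  ring

section derivativeSignal

variable {ψ : ℝ → ℝ} {K : ℝ≥0}

theorem integrable_derivativeSignal (hψ : LipschitzWith K ψ) (β : ℂ) :
    Integrable (derivativeSignal ψ β) μ₀ := by
  have h1 := (memLp_analyticSignal (memLp_circleLift_of_lipschitz hψ)).integrable (by norm_num)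
  have h2 := (memLp_analyticSignal (memLp_circleLift_deriv_of_lipschitz hψ)).integrable
    (by norm_num)
  have h3 : Integrable (fun t : Circle2Pi => (fourier 0 t : ℂ)) μ₀ :=
    (map_continuous (fourier 0)).integrable_of_hasCompactSupport
      (HasCompactSupport.of_compactSpace _)
  exact ((h2.const_mul _).add (h1.const_mul _)).add (h3.const_mul _)

theorem fourierCoeff_derivativeSignal (hψ : LipschitzWith K ψ)
    (hper : Function.Periodic ψ (2 * π)) (β : ℂ) (n : ℤ) :
    fourierCoeff (derivativeSignal ψ β) n =
      (1 + (n.sign : ℂ)) * (n / 2 + β) * fourierCoeff (circleLift ψ) n +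
        if n = 0 then fourierCoeff (circleLift ψ) 0 / 2 else 0 := by
  have m1 := memLp_circleLift_of_lipschitz hψ
  have m2 := memLp_circleLift_deriv_of_lipschitz hψ
  have h1 := (memLp_analyticSignal m1).integrable (by norm_num)
  have h2 := (memLp_analyticSignal m2).integrable (by norm_num)
  have h3 : Integrable (fun t : Circle2Pi => (fourier 0 t : ℂ)) μ₀ :=
    (map_continuous (fourier 0)).integrable_of_hasCompactSupport
      (HasCompactSupport.of_compactSpace _)
  have e : derivativeSignal ψ β =
      ((fun t => -(Complex.I / 2) * analyticSignal (circleLift (deriv ψ)) t) +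
        fun t => β * analyticSignal (circleLift ψ) t) +
        fun t => fourierCoeff (circleLift ψ) 0 / 2 * fourier 0 t := rfl
  have h4 : fourierCoeff (fun t : Circle2Pi => (fourier 0 t : ℂ)) n = if n = 0 then 1 else 0 := by
    rw [fourierCoeff_fourier, Pi.single_apply]
  rw [e, fourierCoeff.add ((h2.const_mul _).add (h1.const_mul _)) (h3.const_mul _), Pi.add_apply,
    fourierCoeff.add (h2.const_mul _) (h1.const_mul _), Pi.add_apply, fourierCoeff.const_mul,
    fourierCoeff.const_mul, fourierCoeff.const_mul, fourierCoeff_analyticSignal m1,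
    fourierCoeff_analyticSignal m2, fourierCoeff_circleLift_deriv hψ hper, h4]
  split_ifs <;>
  linear_combination (-(1 + (n.sign : ℂ)) * n / 2 * fourierCoeff (circleLift ψ) n) * Complex.I_sq

theorem fourierCoeff_derivativeSignal_neg (hψ : LipschitzWith K ψ)
    (hper : Function.Periodic ψ (2 * π)) (β : ℂ) {n : ℤ} (hn : n < 0) :
    fourierCoeff (derivativeSignal ψ β) n = 0 := by
  rw [fourierCoeff_derivativeSignal hψ hper, Int.sign_eq_neg_one_of_neg hn, if_neg hn.ne]
  simp

theorem fourierCoeff_derivativeSignal_pos (hψ : LipschitzWith K ψ)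
    (hper : Function.Periodic ψ (2 * π)) (β : ℂ) {n : ℤ} (hn : 0 < n) :
    fourierCoeff (derivativeSignal ψ β) n = (n + 2 * β) * fourierCoeff (circleLift ψ) n := by
  rw [fourierCoeff_derivativeSignal hψ hper, Int.sign_eq_one_of_pos hn, if_neg hn.ne']
  push_cast
  ring

theorem integral_circlePoisson_mul_le (hψ : LipschitzWith K ψ) {w : ℂ} (hw : ‖w‖ < 1)
    {g : Circle2Pi → ℂ} (hg : ∀ t, ‖g t‖ ≤
      1 / 2 * (amplitude ψ t + amplitude (deriv ψ) t + ‖fourierCoeff (circleLift ψ) 0‖)) :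
    ∫ t, circlePoisson w t * ‖g t‖ ∂μ₀ ≤
      1 / 2 * ((∫ t, circlePoisson w t * amplitude ψ t ∂μ₀) +
        (∫ t, circlePoisson w t * amplitude (deriv ψ) t ∂μ₀) + ∫ t, amplitude ψ t ∂μ₀) := by
  have m1 := memLp_circleLift_of_lipschitz hψ
  have i1 := integrable_circlePoisson_mul_amplitude hw m1
  have i2 := integrable_circlePoisson_mul_amplitude hw (memLp_circleLift_deriv_of_lipschitz hψ)
  have i3 : Integrable (fun t => circlePoisson w t * ‖fourierCoeff (circleLift ψ) 0‖) μ₀ :=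
    integrable_circlePoisson_mul hw (integrable_const _)
  have i12 : Integrable (fun t => circlePoisson w t * amplitude ψ t +
      circlePoisson w t * amplitude (deriv ψ) t) μ₀ := i1.add i2
  have h1 : ∫ t, circlePoisson w t * ‖g t‖ ∂μ₀ ≤ ∫ t, 1 / 2 *
      (circlePoisson w t * amplitude ψ t + circlePoisson w t * amplitude (deriv ψ) t +
        circlePoisson w t * ‖fourierCoeff (circleLift ψ) 0‖) ∂μ₀ := by
    refine integral_mono_of_nonneg (ae_of_all _ fun t =>
      mul_nonneg (circlePoisson_nonneg hw t) (norm_nonneg _))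
      ((i12.add i3).const_mul _) (ae_of_all _ fun t => ?_)
    have := mul_le_mul_of_nonneg_left (hg t) (circlePoisson_nonneg hw t)
    simp only
    linarith
  refine h1.trans ?_
  rw [integral_const_mul, integral_add i12 i3, integral_add i1 i2, integral_mul_const,
    integral_circlePoisson hw, one_mul]
  gcongr
  exact norm_fourierCoeff_zero_le m1

/-- The derivative of the harmonic extension `u` of `e^{iθ} ψ(θ)`. Writing
`u(w) = p(w) + q(w̄)`, the series `p'(w) = ∑ (n + 1) cₙ wⁿ` and the conjugate
`∑ (n + 1) c_{n+2} wⁿ` of `q'(w̄)` are the holomorphic extensions of the derivative signals. -/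
theorem norm_fderiv_le_integral_amplitude (hψ : LipschitzWith K ψ)
    (hper : Function.Periodic ψ (2 * π)) {u : ℂ → ℂ}
    (hu : InnerProductSpace.HarmonicContOnCl u (Metric.ball 0 1))
    (hb : ∀ t, u (toCircle t : Circle) = fourier 1 t * circleLift ψ t) {w : ℂ} (hw : ‖w‖ < 1) :
    ‖fderiv ℝ u w‖ ≤ (∫ t, circlePoisson w t * amplitude ψ t ∂μ₀) +
        (∫ t, circlePoisson w t * amplitude (deriv ψ) t ∂μ₀) + ∫ t, amplitude ψ t ∂μ₀ := by
  set S : ℝ := (∫ t, circlePoisson w t * amplitude ψ t ∂μ₀) +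
    (∫ t, circlePoisson w t * amplitude (deriv ψ) t ∂μ₀) + ∫ t, amplitude ψ t ∂μ₀ with hS
  set c : ℤ → ℂ := fourierCoeff (circleLift ψ) with hc
  set g : Circle2Pi → ℂ := fun t => fourier 1 t * circleLift ψ t with hg
  have hgc : ∀ n, fourierCoeff g n = c (n - 1) := fun n => fourierCoeff_fourier_mul 1 n _
  have hgb : ∀ n : ℤ, ‖fourierCoeff g n‖ ≤ ∫ t, ‖g t‖ ∂μ₀ := fun n => norm_fourierCoeff_le n
  have hcsymm : ∀ n, c (-n) = conj (c n) := fun n => by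
    have := fourierCoeff_conj (circleLift ψ) (-n)
    simp only [conj_circleLift, neg_neg] at this
    exact this
  have hconj : ‖conj w‖ < 1 := by rwa [RCLike.norm_conj]
  have hp := hasDerivAt_tsum_mul_pow (a := fun n : ℕ => fourierCoeff g n) (fun n => hgb n) hw
  have hq := hasDerivAt_tsum_mul_pow
    (a := fun n : ℕ => if n = 0 then 0 else fourierCoeff g (-n)) (C := ∫ t, ‖g t‖ ∂μ₀)
    (fun n => by
      split_ifs
      · simpa using integral_nonneg fun t => norm_nonneg (g t)
      · exact hgb _) hconj
  have heq : u =ᶠ[nhds w] fun z => (∑' n : ℕ, fourierCoeff g n * z ^ n) +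
      ∑' n : ℕ, (if n = 0 then 0 else fourierCoeff g (-n)) * conj z ^ n := by
    filter_upwards [Metric.isOpen_ball.mem_nhds (mem_ball_zero_iff.2 hw)] with z hz
    exact eq_tsum_add_tsum_conj hu (mem_ball_zero_iff.1 hz) hb
  rw [heq.fderiv_eq]
  refine (norm_fderiv_add_comp_conj_le hp hq).trans ?_
  have half : ‖(1 / 2 : ℂ)‖ = 1 / 2 := by norm_num
  have B1 : ‖∑' n : ℕ, ((n : ℂ) + 1) * fourierCoeff g ((n + 1 : ℕ) : ℤ) * w ^ n‖ ≤ 1 / 2 * S := by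
    have e : ∀ n : ℕ, ((n : ℂ) + 1) * fourierCoeff g ((n + 1 : ℕ) : ℤ) =
        fourierCoeff (derivativeSignal ψ (1 / 2)) n := fun n => by
      rw [hgc]
      rcases n.eq_zero_or_pos with rfl | hn
      · rw [fourierCoeff_derivativeSignal hψ hper]
        simp only [Nat.cast_zero, Int.sign_zero, Int.cast_zero, if_true, ← hc]
        norm_num
        ring
      · rw [fourierCoeff_derivativeSignal_pos hψ hper _ (by exact_mod_cast hn)]
        push_cast
        rw [add_sub_cancel_right]
        ring
    simp only [e]
    exact (norm_tsum_le_integral_circlePoisson hw (integrable_derivativeSignal hψ _)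
      fun n hn => fourierCoeff_derivativeSignal_neg hψ hper _ hn).trans
      (integral_circlePoisson_mul_le hψ hw fun t => norm_derivativeSignal_le ψ half t)
  have B2 : ‖∑' n : ℕ, ((n : ℂ) + 1) *
      (if n + 1 = 0 then 0 else fourierCoeff g (-((n + 1 : ℕ) : ℤ))) * conj w ^ n‖ ≤ 1 / 2 * S := by
    set G : Circle2Pi → ℂ := fun t => fourier (-2) t * derivativeSignal ψ (-(1 / 2)) t with hG
    have hGi : Integrable G μ₀ := (integrable_derivativeSignal hψ _).fourier_smul (-2)
    have hGc : ∀ n : ℤ, -1 ≤ n → fourierCoeff G n = (n + 1) * c (n + 2) := fun n hn => by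
      rw [hG, fourierCoeff_fourier_mul, fourierCoeff_derivativeSignal_pos hψ hper _ (by omega),
        sub_neg_eq_add]
      push_cast
      ring
    have e : ∀ n : ℕ, ((n : ℂ) + 1) *
        (if n + 1 = 0 then 0 else fourierCoeff g (-((n + 1 : ℕ) : ℤ))) * conj w ^ n =
        conj (fourierCoeff G n * w ^ n) := fun n => by
      rw [if_neg (Nat.succ_ne_zero n), hgc, hGc n (by omega), map_mul, map_pow, map_mul, map_add,
        ← hcsymm, show -((n + 1 : ℕ) : ℤ) - 1 = -((n : ℤ) + 2) by push_cast; ring]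
      simp
    simp only [e]
    rw [← Complex.conj_tsum, RCLike.norm_conj]
    refine (norm_tsum_le_integral_circlePoisson hw hGi fun n hn => ?_).trans
      (integral_circlePoisson_mul_le hψ hw fun t => ?_)
    -- At `-1` and `-2` the shifted coefficients vanish because `n - 1` does at `1`, and because
    -- `c₀ / 2` cancels `β c₀`.
    · rcases (by omega : n = -1 ∨ n = -2 ∨ n < -2) with rfl | rfl | h
      · rw [hGc _ le_rfl]
        simp
      · rw [hG, fourierCoeff_fourier_mul, fourierCoeff_derivativeSignal hψ hper]
        norm_num
        ring
      · rw [hG, fourierCoeff_fourier_mul,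
          fourierCoeff_derivativeSignal_neg hψ hper _ (by omega)]
    · rw [hG]
      simp only
      rw [norm_mul, fourier_apply, Circle.norm_coe, one_mul]
      exact norm_derivativeSignal_le ψ (by rw [norm_neg, half]) t
  refine (add_le_add B1 B2).trans_eq ?_
  ring

end derivativeSignal

end InteriorBounds

/-! ### Radial limits of derivatives of harmonic functions -/

section RadialLimits

open InnerProductSpace Metric Filter Topology

/-- Gradient estimate for a bounded harmonic function. If `v = Re F`, the Cauchy estimate is applied
to `exp (F / M)`, whose modulus lies between `exp (-1)` and `exp 1`. -/
theorem norm_fderiv_le_of_harmonicOnNhd_ball {v : ℂ → ℝ} {y : ℂ} {s M : ℝ} (hs : 0 < s)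
    (hM : 0 < M) (hv : HarmonicOnNhd v (ball y s)) (hb : ∀ z ∈ ball y s, |v z| ≤ M) :
    ‖fderiv ℝ v y‖ ≤ 2 * exp 2 * M / s := by
  obtain ⟨F, hF, hFv'⟩ := hv.exists_analyticOnNhd_ball_re_eq
  have hFv : ∀ z ∈ ball y s, (F z).re = v z := hFv'
  have hy : y ∈ ball y s := mem_ball_self hs
  have hg : ∀ z, ‖Complex.exp (F z / M)‖ = exp ((F z).re / M) := fun z => by
    rw [Complex.norm_exp, Complex.div_ofReal_re]
  have hsub : closedBall y (s / 2) ⊆ ball y s := closedBall_subset_ball (by linarith)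
  have hd : DifferentiableOn ℂ (fun z => Complex.exp (F z / M)) (ball y s) :=
    (hF.differentiableOn.div_const _).cexp
  have hF' : HasDerivAt F (deriv F y) y := (hF y hy).differentiableAt.hasDerivAt
  have hle := Complex.norm_deriv_le_of_forall_mem_sphere_norm_le (C := exp 1) (half_pos hs)
    ((hd.mono hsub).diffContOnCl_ball subset_rfl) (fun z hz => by
      have hz' := hsub (sphere_subset_closedBall hz)
      rw [hg, hFv z hz', exp_le_exp, div_le_one hM]
      exact (abs_le.1 (hb z hz')).2)
  rw [((hF'.div_const (M : ℂ)).cexp).deriv, norm_mul, hg, hFv y hy, norm_div, Complex.norm_real,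
    Real.norm_of_nonneg hM.le] at hle
  have hlow : exp (-1) ≤ exp (v y / M) := by
    rw [exp_le_exp, le_div_iff₀ hM]
    linarith [(abs_le.1 (hb y hy)).1]
  have h1 : exp (-1) * (‖deriv F y‖ / M) ≤ exp 1 / (s / 2) :=
    (mul_le_mul_of_nonneg_right hlow (by positivity)).trans hle
  have h2 : ‖deriv F y‖ ≤ 2 * exp 2 * M / s := by
    have e2 : exp 2 = exp 1 * exp 1 := by rw [← exp_add]; norm_num
    have e3 : exp 1 * exp (-1) = 1 := by rw [← exp_add]; simp
    calc ‖deriv F y‖ = (exp 1 * M) * (exp (-1) * (‖deriv F y‖ / M)) := by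
          field_simp
          linear_combination (-‖deriv F y‖) * e3
      _ ≤ (exp 1 * M) * (exp 1 / (s / 2)) := by gcongr
      _ = _ := by rw [e2]; field_simp
  have hvF : v =ᶠ[𝓝 y] fun z => (F z).re := by
    filter_upwards [isOpen_ball.mem_nhds hy] with z hz using (hFv z hz).symm
  have hfd : HasFDerivAt (fun z => (F z).re) _ y :=
    Complex.reCLM.hasFDerivAt.comp y (hF'.hasFDerivAt.restrictScalars ℝ)
  rw [hvF.fderiv_eq, hfd.fderiv]
  refine ContinuousLinearMap.opNorm_le_bound _ (by positivity) fun h => ?_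
  rw [ContinuousLinearMap.comp_apply, Complex.reCLM_apply, Real.norm_eq_abs]
  refine (Complex.abs_re_le_norm _).trans ?_
  simp only [ContinuousLinearMap.coe_restrictScalars', ContinuousLinearMap.toSpanSingleton_apply,
    norm_smul]
  rw [mul_comm]
  gcongr

theorem norm_fderiv_le_of_harmonicOnNhd_ball_complex {u : ℂ → ℂ} {y : ℂ} {s M : ℝ} (hs : 0 < s)
    (hM : 0 < M) (hu : HarmonicOnNhd u (ball y s)) (hb : ∀ z ∈ ball y s, ‖u z‖ ≤ M) :
    ‖fderiv ℝ u y‖ ≤ 4 * exp 2 * M / s := by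
  have hd : HasFDerivAt u (fderiv ℝ u y) y :=
    ((hu y (mem_ball_self hs)).1.differentiableAt two_ne_zero).hasFDerivAt
  have h1 := norm_fderiv_le_of_harmonicOnNhd_ball hs hM (hu.comp_CLM Complex.reCLM)
    fun z hz => (Complex.abs_re_le_norm _).trans (hb z hz)
  have h2 := norm_fderiv_le_of_harmonicOnNhd_ball hs hM (hu.comp_CLM Complex.imCLM)
    fun z hz => (Complex.abs_im_le_norm _).trans (hb z hz)
  rw [(Complex.reCLM.hasFDerivAt.comp y hd).fderiv] at h1
  rw [(Complex.imCLM.hasFDerivAt.comp y hd).fderiv] at h2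
  refine ContinuousLinearMap.opNorm_le_bound _ (by positivity) fun h => ?_
  have h3 := ContinuousLinearMap.le_of_opNorm_le _ h1 h
  have h4 := ContinuousLinearMap.le_of_opNorm_le _ h2 h
  simp only [ContinuousLinearMap.comp_apply, Complex.reCLM_apply, Complex.imCLM_apply,
    Real.norm_eq_abs] at h3 h4
  refine (Complex.norm_le_abs_re_add_abs_im _).trans ((add_le_add h3 h4).trans_eq ?_)
  ring

theorem harmonicAt_continuousLinearMap (L : ℂ →L[ℝ] ℂ) (z : ℂ) : HarmonicAt L z :=
  (analyticAt_id (𝕜 := ℂ) (z := z)).harmonicAt.comp_CLM L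

/-- If a harmonic function is differentiable relative to the closed disc at a boundary point, then
its derivatives along the radius converge to this derivative: the gradient estimate is applied to
the remainder of the first-order expansion on the discs `ball (t x) (1 - t)`. -/
theorem tendsto_fderiv_radial {u : ℂ → ℂ} (hu : HarmonicOnNhd u (ball 0 1)) {x : ℂ} (hx : ‖x‖ = 1)
    {L : ℂ →L[ℝ] ℂ} (hL : HasFDerivWithinAt u L (closedBall 0 1) x) :
    Tendsto (fun t : ℝ => fderiv ℝ u (t • x)) (𝓝[<] 1) (𝓝 L) := by
  rw [Metric.tendsto_nhds]
  intro ε hε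
  set η : ℝ := ε / (16 * exp 2) with hη
  have hη0 : 0 < η := by positivity
  have hev := (hasFDerivWithinAt_iff_isLittleO.1 hL).def hη0
  rw [eventually_nhdsWithin_iff, Metric.eventually_nhds_iff] at hev
  obtain ⟨δ, hδ, hev⟩ := hev
  have hmem : Set.Ioo (max 0 (1 - δ / 2)) 1 ∈ 𝓝[<] (1 : ℝ) :=
    Ioo_mem_nhdsLT (by simp [hδ])
  filter_upwards [hmem] with t ht
  have ht0 : 0 < t := (le_max_left _ _).trans_lt ht.1
  have htδ : 1 - δ / 2 < t := (le_max_right _ _).trans_lt ht.1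
  have hs : 0 < 1 - t := by linarith [ht.2]
  have hsub : ball (t • x) (1 - t) ⊆ ball 0 1 := by
    refine ball_subset_ball' ?_
    rw [dist_zero_right, norm_smul, hx, Real.norm_of_nonneg ht0.le]
    linarith
  have hxt : ‖t • x - x‖ = 1 - t := by
    rw [show t • x - x = (t - 1) • x by rw [sub_smul, one_smul], norm_smul, hx, mul_one,
      Real.norm_eq_abs, abs_sub_comm, abs_of_pos hs]
  set R : ℂ → ℂ := u - ⇑L - fun _ => u x - L x with hR
  have hRh : HarmonicOnNhd R (ball (t • x) (1 - t)) := fun z hz =>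
    ((hu z (hsub hz)).sub (harmonicAt_continuousLinearMap L z)).sub (harmonicAt_const _)
  have hRb : ∀ z ∈ ball (t • x) (1 - t), ‖R z‖ ≤ η * (2 * (1 - t)) := fun z hz => by
    have hzx : ‖z - x‖ ≤ 2 * (1 - t) := by
      have h1 := norm_sub_le_norm_sub_add_norm_sub z (t • x) x
      rw [hxt] at h1
      have h2 := mem_ball_iff_norm.1 hz
      linarith
    have h3 := hev (y := z) (by rw [dist_eq_norm]; linarith) (ball_subset_closedBall (hsub hz))
    rw [map_sub] at h3
    have h4 : R z = u z - u x - (L z - L x) := by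
      simp only [hR, Pi.sub_apply]
      ring
    rw [h4]
    exact h3.trans (by gcongr)
  have hbd := norm_fderiv_le_of_harmonicOnNhd_ball_complex hs (by positivity) hRh hRb
  have hud : HasFDerivAt u (fderiv ℝ u (t • x)) (t • x) :=
    ((hu _ (hsub (mem_ball_self hs))).1.differentiableAt two_ne_zero).hasFDerivAt
  have hRd : fderiv ℝ R (t • x) = fderiv ℝ u (t • x) - L :=
    ((hud.sub L.hasFDerivAt).sub_const _).fderiv
  rw [hRd] at hbd
  rw [dist_eq_norm]
  refine hbd.trans_lt ?_
  rw [hη]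
  have : 4 * exp 2 * (ε / (16 * exp 2) * (2 * (1 - t))) / (1 - t) = ε / 2 := by
    field_simp
    norm_num
  linarith

end RadialLimits

/-! ### Passage from the plane to the unit disc of the complex numbers -/

section Coordinates

open InnerProductSpace Metric Filter Topology

/-- The Laplacian of the composition with a linear similarity. -/
theorem laplacian_comp_smul_linearIsometryEquiv {E F G : Type*} [NormedAddCommGroup E]
    [InnerProductSpace ℝ E] [FiniteDimensional ℝ E] [NormedAddCommGroup F] [InnerProductSpace ℝ F]
    [FiniteDimensional ℝ F] [NormedAddCommGroup G] [NormedSpace ℝ G] (e : E ≃ₗᵢ[ℝ] F)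
    {A : E ≃L[ℝ] F} {r : ℝ} (hA : ∀ z, A z = r • e z) (f : F → G) (z : E) :
    Laplacian.laplacian (f ∘ A) z = r ^ 2 • Laplacian.laplacian f (A z) := by
  set b := stdOrthonormalBasis ℝ E
  rw [laplacian_eq_iteratedFDeriv_orthonormalBasis _ b,
    laplacian_eq_iteratedFDeriv_orthonormalBasis _ (b.map e)]
  simp only [← iteratedFDerivWithin_univ, Finset.smul_sum]
  refine Finset.sum_congr rfl fun i _ => ?_
  have h := A.iteratedFDerivWithin_comp_right f uniqueDiffOn_univ (x := z) (Set.mem_univ _) 2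
  rw [Set.preimage_univ] at h
  rw [h, ContinuousMultilinearMap.compContinuousLinearMap_apply]
  have h2 : (fun j : Fin 2 => (A : E →L[ℝ] F) (![b i, b i] j)) =
      fun j => r • ![(b.map e) i, (b.map e) i] j := by
    ext j
    fin_cases j <;> simp [hA]
  rw [h2, ContinuousMultilinearMap.map_smul_univ]
  simp

theorem harmonicAt_comp_smul_linearIsometryEquiv {E F G : Type*} [NormedAddCommGroup E]
    [InnerProductSpace ℝ E] [FiniteDimensional ℝ E] [NormedAddCommGroup F] [InnerProductSpace ℝ F]
    [FiniteDimensional ℝ F] [NormedAddCommGroup G] [NormedSpace ℝ G] (e : E ≃ₗᵢ[ℝ] F)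
    {A : E ≃L[ℝ] F} {r : ℝ} (hA : ∀ z, A z = r • e z) {f : F → G} {z : E}
    (hf : HarmonicAt f (A z)) :
    HarmonicAt (f ∘ A) z := by
  refine ⟨hf.1.comp z A.contDiff.contDiffAt, ?_⟩
  filter_upwards [A.continuous.continuousAt.eventually hf.2] with y hy
  rw [laplacian_comp_smul_linearIsometryEquiv e hA, hy]
  simp

/-- The identification of `ℂ` with the plane that maps the unit disc onto the disc of
radius `|r|`. -/
noncomputable def scaledPlane (r : ℝˣ) : ℂ ≃L[ℝ] Plane :=
  Complex.orthonormalBasisOneI.repr.toContinuousLinearEquiv.trans (ContinuousLinearEquiv.smulLeft r)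

theorem scaledPlane_apply (r : ℝˣ) (z : ℂ) :
    scaledPlane r z = (r : ℝ) • Complex.orthonormalBasisOneI.repr z := rfl

theorem norm_scaledPlane (r : ℝˣ) (z : ℂ) : ‖scaledPlane r z‖ = |(r : ℝ)| * ‖z‖ := by
  rw [scaledPlane_apply, norm_smul, LinearIsometryEquiv.norm_map, Real.norm_eq_abs]

theorem scaledPlane_preimage_disc {r : ℝˣ} (hr : 0 < (r : ℝ)) :
    scaledPlane r ⁻¹' disc r = closedBall 0 1 := by
  ext z
  rw [Set.mem_preimage, disc, mem_closedBall_zero_iff, mem_closedBall_zero_iff, norm_scaledPlane,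
    abs_of_pos hr, mul_le_iff_le_one_right hr]

/-- A map of the plane, read in the complex coordinate in which the disc of radius `|r|` is the
unit disc. -/
noncomputable def inComplexCoordinate (r : ℝˣ) (Φ : Plane → Plane) : ℂ → ℂ :=
  Complex.orthonormalBasisOneI.repr.symm ∘ Φ ∘ scaledPlane r

theorem inComplexCoordinate_apply (r : ℝˣ) (Φ : Plane → Plane) (z : ℂ) :
    inComplexCoordinate r Φ z = Φ (scaledPlane r z) 0 + Φ (scaledPlane r z) 1 * Complex.I := rfl

theorem b_scaledPlane {r : ℝˣ} (hr : 0 < (r : ℝ)) (Φ : Plane → Plane) {z : ℂ}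
    (hz : z ∈ closedBall (0 : ℂ) 1) :
    b r Φ (scaledPlane r z) = ‖inComplexCoordinate r Φ z‖ +
      √2 / r * ‖fderivWithin ℝ (inComplexCoordinate r Φ) (closedBall 0 1) z‖ := by
  have hU : UniqueDiffWithinAt ℝ (closedBall (0 : ℂ) 1) z :=
    uniqueDiffOn_convex (convex_closedBall 0 1)
      ⟨0, by rw [interior_closedBall _ one_ne_zero]; exact mem_ball_self one_pos⟩ z hz
  have h1 := Complex.orthonormalBasisOneI.repr.symm.comp_fderivWithin
    (f := Φ ∘ scaledPlane r) hU
  have h2 := (scaledPlane r).comp_right_fderivWithin (f := Φ) (s := disc r) (x := z)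
    (by rwa [scaledPlane_preimage_disc hr])
  rw [scaledPlane_preimage_disc hr] at h2
  set T := fderivWithin ℝ Φ (disc r) (scaledPlane r z) with hT
  have h3 : T.comp (scaledPlane r : ℂ →L[ℝ] Plane) =
      (r : ℝ) • T.comp (Complex.orthonormalBasisOneI.repr : ℂ →L[ℝ] Plane) := by
    ext1 v
    simp [scaledPlane_apply]
  have h4 : ‖fderivWithin ℝ (inComplexCoordinate r Φ) (closedBall 0 1) z‖ = r * ‖T‖ := by
    rw [inComplexCoordinate, h1, h2, h3]
    have h5 := LinearIsometry.norm_toContinuousLinearMap_comp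
      Complex.orthonormalBasisOneI.repr.symm.toLinearIsometry
      (g := (r : ℝ) • T.comp (Complex.orthonormalBasisOneI.repr : ℂ →L[ℝ] Plane))
    refine h5.trans ?_
    rw [norm_smul, ContinuousLinearMap.opNorm_comp_linearIsometryEquiv, Real.norm_of_nonneg hr.le]
  rw [h4, b, inComplexCoordinate, Function.comp_apply, Function.comp_apply,
    LinearIsometryEquiv.norm_map, ← hT]
  field_simp

section partialMap

variable {r : ℝˣ} {ψ : ℝ → ℝ} {Φ : Plane → Plane}

theorem harmonicContOnCl_inComplexCoordinate (hr : 0 < (r : ℝ))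
    (hΦ : IsHarmonicPartialMap r ψ Φ) :
    HarmonicContOnCl (inComplexCoordinate r Φ) (ball 0 1) := by
  have hmaps : Set.MapsTo (scaledPlane r) (closedBall 0 1) (disc r) := fun z hz => by
    rwa [← scaledPlane_preimage_disc hr] at hz
  have hint : ∀ z ∈ ball (0 : ℂ) 1, scaledPlane r z ∈ interior (disc r) := fun z hz => by
    rw [disc, interior_closedBall _ hr.ne', mem_ball_zero_iff, norm_scaledPlane, abs_of_pos hr]
    exact mul_lt_of_lt_one_right hr (mem_ball_zero_iff.1 hz)
  have hcomp : ∀ {φ : ℝ → ℝ} {v : Plane → ℝ}, SolvesDirichlet r φ v →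
      HarmonicContOnCl (v ∘ scaledPlane r) (ball 0 1) := fun hv =>
    HarmonicContOnCl.mk_ball
      (fun z hz => harmonicAt_comp_smul_linearIsometryEquiv Complex.orthonormalBasisOneI.repr
        (scaledPlane_apply r) (hv.harmonic _ (hint z hz)))
      (hv.continuousOn.comp (scaledPlane r).continuous.continuousOn hmaps)
  convert ((hcomp hΦ.fst).comp_CLM (ContinuousLinearMap.toSpanSingleton ℝ (1 : ℂ))).add
    ((hcomp hΦ.snd).comp_CLM (ContinuousLinearMap.toSpanSingleton ℝ Complex.I)) using 1
  ext z
  simp [inComplexCoordinate_apply]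

theorem inComplexCoordinate_toCircle (hψ : Function.Periodic ψ (2 * π))
    (hΦ : IsHarmonicPartialMap r ψ Φ) (t : Circle2Pi) :
    inComplexCoordinate r Φ (AddCircle.toCircle t : Circle) = fourier 1 t * circleLift ψ t := by
  induction t using QuotientAddGroup.induction_on with
  | H θ =>
    have hz : ((AddCircle.toCircle (θ : Circle2Pi) : Circle) : ℂ) =
        Complex.exp (θ * Complex.I) := by
      simp [AddCircle.toCircle_apply_mk]
    have hA : scaledPlane r (Complex.exp (θ * Complex.I)) =
        !₂[(r : ℝ) * cos θ, (r : ℝ) * sin θ] := by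
      rw [scaledPlane_apply]
      ext i
      fin_cases i
      · simp [Complex.exp_ofReal_mul_I_re]
      · simp [Complex.exp_ofReal_mul_I_im]
    have h1 := hΦ.fst.boundary θ
    have h2 := hΦ.snd.boundary θ
    simp only at h1 h2
    have h3 : fourier 1 (θ : Circle2Pi) = Complex.exp (θ * Complex.I) := by
      rw [fourier_one, hz]
    change _ = fourier 1 (θ : Circle2Pi) * circleLift ψ (θ : Circle2Pi)
    rw [inComplexCoordinate_apply, h3, circleLift_coe hψ]
    rw [hz, hA, h1, h2, Complex.exp_mul_I]
    push_cast
    ring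

end partialMap

end Coordinates

/-! ### Summation over the partial maps -/

section Summation

open InnerProductSpace Metric Filter Topology

/-- Harmonic measure of the unit disc at `w`: the Poisson kernel times the normalised arc length. -/
noncomputable def harmonicMeasure (w : ℂ) : Measure Circle2Pi :=
  (μ₀).withDensity fun t => ENNReal.ofReal (circlePoisson w t)

theorem harmonicMeasure_absolutelyContinuous (w : ℂ) : harmonicMeasure w ≪ μ₀ :=
  withDensity_absolutelyContinuous _ _

theorem lintegral_harmonicMeasure {w : ℂ} (hw : ‖w‖ < 1) {f : Circle2Pi → ℝ}
    (hf : Integrable (fun t => circlePoisson w t * f t) μ₀) (hf0 : ∀ t, 0 ≤ f t) :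
    ∫⁻ t, ENNReal.ofReal (f t) ∂harmonicMeasure w =
      ENNReal.ofReal (∫ t, circlePoisson w t * f t ∂μ₀) := by
  rw [ofReal_integral_eq_lintegral_ofReal hf
    (ae_of_all _ fun t => mul_nonneg (circlePoisson_nonneg hw t) (hf0 t)), harmonicMeasure,
    lintegral_withDensity_eq_lintegral_mul_non_measurable _
      (continuous_circlePoisson hw).measurable.ennreal_ofReal (ae_of_all _ fun _ => by simp)]
  refine lintegral_congr fun t => ?_
  rw [Pi.mul_apply, ENNReal.ofReal_mul (circlePoisson_nonneg hw t)]

theorem isProbabilityMeasure_harmonicMeasure {w : ℂ} (hw : ‖w‖ < 1) :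
    IsProbabilityMeasure (harmonicMeasure w) := by
  refine ⟨?_⟩
  have h := lintegral_harmonicMeasure hw (f := fun _ => 1)
    (integrable_circlePoisson_mul (E := ℝ) hw (integrable_const _)) fun _ => zero_le_one
  simpa [integral_circlePoisson hw] using h

theorem lintegral_const_mul_amplitude {ρ : ℝ} (hρ : 0 ≤ ρ) {w : ℂ} (hw : ‖w‖ < 1) {f : ℝ → ℝ}
    (hf : MemLp (circleLift f) 2 μ₀) :
    ∫⁻ t, ENNReal.ofReal (ρ * amplitude f t) ∂harmonicMeasure w =
      ENNReal.ofReal (ρ * ∫ t, circlePoisson w t * amplitude f t ∂μ₀) := by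
  rw [lintegral_harmonicMeasure hw _ fun t => mul_nonneg hρ (amplitude_nonneg f t),
    ← integral_const_mul]
  · simp only [mul_left_comm]
  · simpa only [mul_left_comm] using (integrable_circlePoisson_mul_amplitude hw hf).const_mul ρ

/-- The pointwise bound on `b` at an interior point, with `λ = √2 / r`. -/
theorem b_scaledPlane_le {r : ℝˣ} (hr : 0 < (r : ℝ)) {ψ : ℝ → ℝ} {K : ℝ≥0}
    (hψ : LipschitzWith K ψ) (hper : Function.Periodic ψ (2 * π)) {Φ : Plane → Plane}
    (hΦ : IsHarmonicPartialMap r ψ Φ) {w : ℂ} (hw : ‖w‖ < 1) :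
    b r Φ (scaledPlane r w) ≤
      (1 + √2 / r) * (∫ t, circlePoisson w t * amplitude ψ t ∂μ₀) +
      √2 / r * (∫ t, circlePoisson w t * amplitude (deriv ψ) t ∂μ₀) +
      √2 / r * ∫ t, amplitude ψ t ∂μ₀ := by
  have hu := harmonicContOnCl_inComplexCoordinate hr hΦ
  have hb := inComplexCoordinate_toCircle hper hΦ
  have hwb : w ∈ ball (0 : ℂ) 1 := mem_ball_zero_iff.2 hw
  have h1 := norm_le_integral_circlePoisson_amplitude (memLp_circleLift_of_lipschitz hψ) hu hb hw
  have h2 := norm_fderiv_le_integral_amplitude hψ hper hu hb hw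
  rw [b_scaledPlane hr Φ (ball_subset_closedBall hwb),
    fderivWithin_of_mem_nhds (mem_of_superset (isOpen_ball.mem_nhds hwb) ball_subset_closedBall)]
  have h3 := mul_le_mul_of_nonneg_left h2 (by positivity : 0 ≤ √2 / (r : ℝ))
  linarith

theorem ofReal_mul_b_le {r : ℝˣ} (hr : 0 < (r : ℝ)) {ψ : ℝ → ℝ} {K : ℝ≥0}
    (hψ : LipschitzWith K ψ) (hper : Function.Periodic ψ (2 * π)) {Φ : Plane → Plane}
    (hΦ : IsHarmonicPartialMap r ψ Φ) {w : ℂ} (hw : ‖w‖ < 1) {ρ : ℝ} (hρ : 0 ≤ ρ) :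
    ENNReal.ofReal (ρ * b r Φ (scaledPlane r w)) ≤
      ENNReal.ofReal (1 + √2 / r) *
        ∫⁻ t, ENNReal.ofReal (ρ * amplitude ψ t) ∂harmonicMeasure w +
      ENNReal.ofReal (√2 / r) *
        ∫⁻ t, ENNReal.ofReal (ρ * amplitude (deriv ψ) t) ∂harmonicMeasure w +
      ENNReal.ofReal (√2 / r) * ∫⁻ t, ENNReal.ofReal (ρ * amplitude ψ t) ∂μ₀ := by
  have m1 := memLp_circleLift_of_lipschitz hψ
  have m2 := memLp_circleLift_deriv_of_lipschitz hψ
  have n1 : 0 ≤ ∫ t, circlePoisson w t * amplitude ψ t ∂μ₀ := integral_nonneg fun t =>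
    mul_nonneg (circlePoisson_nonneg hw t) (amplitude_nonneg _ t)
  have n2 : 0 ≤ ∫ t, circlePoisson w t * amplitude (deriv ψ) t ∂μ₀ := integral_nonneg fun t =>
    mul_nonneg (circlePoisson_nonneg hw t) (amplitude_nonneg _ t)
  have n3 : 0 ≤ ∫ t, amplitude ψ t ∂μ₀ := integral_nonneg (amplitude_nonneg ψ)
  rw [lintegral_const_mul_amplitude hρ hw m1, lintegral_const_mul_amplitude hρ hw m2,
    ← ofReal_integral_eq_lintegral_ofReal ((integrable_amplitude m1).const_mul ρ)
      (ae_of_all _ fun t => mul_nonneg hρ (amplitude_nonneg ψ t)), integral_const_mul,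
    ← ENNReal.ofReal_mul (by positivity), ← ENNReal.ofReal_mul (by positivity),
    ← ENNReal.ofReal_mul (by positivity), ← ENNReal.ofReal_add (by positivity) (by positivity),
    ← ENNReal.ofReal_add (by positivity) (by positivity)]
  apply ENNReal.ofReal_le_ofReal
  have := mul_le_mul_of_nonneg_left (b_scaledPlane_le hr hψ hper hΦ hw) hρ
  linarith

/-- At a boundary point `b` is the radial limit of a function that `b` dominates along the radius.
If the partial map is differentiable there, this function is `b` itself; otherwise the derivative
term of `b` vanishes at the boundary point and is dropped along the radius. -/
theorem exists_tendsto_radial_le_b {r : ℝˣ} (hr : 0 < (r : ℝ)) {ψ : ℝ → ℝ} {Φ : Plane → Plane}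
    (hΦ : IsHarmonicPartialMap r ψ Φ) {z : ℂ} (hz : ‖z‖ = 1) :
    ∃ l : ℝ → ℝ, Tendsto l (𝓝[<] 1) (𝓝 (b r Φ (scaledPlane r z))) ∧
      ∀ᶠ t : ℝ in 𝓝[<] 1, l t ≤ b r Φ (scaledPlane r (t • z)) := by
  have hu := harmonicContOnCl_inComplexCoordinate hr hΦ
  set u := inComplexCoordinate r Φ
  have hev : ∀ᶠ t : ℝ in 𝓝[<] 1, t • z ∈ ball (0 : ℂ) 1 := by
    filter_upwards [Ioo_mem_nhdsLT (zero_lt_one' ℝ)] with t ht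
    rw [mem_ball_zero_iff, norm_smul, hz, mul_one, Real.norm_of_nonneg ht.1.le]
    exact ht.2
  have hzc : z ∈ closedBall (0 : ℂ) 1 := mem_closedBall_zero_iff.2 hz.le
  have hb : ∀ᶠ t : ℝ in 𝓝[<] 1, b r Φ (scaledPlane r (t • z)) =
      ‖u (t • z)‖ + √2 / r * ‖fderiv ℝ u (t • z)‖ := by
    filter_upwards [hev] with t ht
    rw [b_scaledPlane hr Φ (ball_subset_closedBall ht),
      fderivWithin_of_mem_nhds (mem_of_superset (isOpen_ball.mem_nhds ht) ball_subset_closedBall)]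
  have hray : Tendsto (fun t : ℝ => t • z) (𝓝[<] 1) (𝓝[closedBall 0 1] z) := by
    refine tendsto_nhdsWithin_iff.2 ⟨?_, hev.mono fun t ht => ball_subset_closedBall ht⟩
    have : Tendsto (fun t : ℝ => t • z) (𝓝 1) (𝓝 ((1 : ℝ) • z)) :=
      (continuous_id.smul continuous_const).tendsto 1
    rw [one_smul] at this
    exact this.mono_left nhdsWithin_le_nhds
  have hlim : Tendsto (fun t : ℝ => ‖u (t • z)‖) (𝓝[<] 1) (𝓝 ‖u z‖) :=
    ((hu.continuousOn_ball z hzc).tendsto.comp hray).norm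
  rw [b_scaledPlane hr Φ hzc]
  by_cases hd : DifferentiableWithinAt ℝ u (closedBall 0 1) z
  · exact ⟨fun t => ‖u (t • z)‖ + √2 / r * ‖fderiv ℝ u (t • z)‖,
      hlim.add ((tendsto_fderiv_radial hu.1 hz hd.hasFDerivWithinAt).norm.const_mul _),
      hb.mono fun t ht => ht.ge⟩
  · refine ⟨fun t => ‖u (t • z)‖, ?_, hb.mono fun t ht => ?_⟩
    · rw [fderivWithin_zero_of_not_differentiableWithinAt hd]
      simpa using hlim
    · rw [ht]
      exact le_add_of_nonneg_right (by positivity)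

section series

variable {r : ℝˣ} {ψ : ℕ → ℝ → ℝ} {Φ : ℕ → Plane → Plane} {ρ : ℕ → ℝ}

/-- The bound at interior points: summation under the integral sign, and comparison of the two
integrands with a constant that bounds the right-hand side almost everywhere. -/
theorem tsum_b_le_of_ae_le (hr : 0 < (r : ℝ)) (hper : ∀ j, Function.Periodic (ψ j) (2 * π))
    (hψ : ∀ j, ∃ K, LipschitzWith K (ψ j)) (hΦ : ∀ j, IsHarmonicPartialMap r (ψ j) (Φ j))
    (hρ : ∀ j, 0 < ρ j) {T : ℝ≥0∞}
    (hT : ∀ᵐ θ ∂μ₀, ENNReal.ofReal (4 * √2 * max 1 (r : ℝ)⁻¹ + 1) *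
            ∑' j, ENNReal.ofReal (ρ j * amplitude (ψ j) θ) +
          ENNReal.ofReal (4 * √2 * max 1 (r : ℝ)⁻¹) *
            ∑' j, ENNReal.ofReal (ρ j * amplitude (deriv (ψ j)) θ) ≤ T)
    {w : ℂ} (hw : ‖w‖ < 1) :
    ∑' j, ENNReal.ofReal (ρ j * b r (Φ j) (scaledPlane r w)) ≤ T := by
  choose K hK using hψ
  set a : Circle2Pi → ℝ≥0∞ := fun θ => ∑' j, ENNReal.ofReal (ρ j * amplitude (ψ j) θ)
  set a' : Circle2Pi → ℝ≥0∞ := fun θ => ∑' j, ENNReal.ofReal (ρ j * amplitude (deriv (ψ j)) θ)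
  set l : ℝ := √2 / r with hl
  have hl0 : 0 ≤ l := by positivity
  have hac := harmonicMeasure_absolutelyContinuous w
  have : IsProbabilityMeasure (harmonicMeasure w) := isProbabilityMeasure_harmonicMeasure hw
  have meas : ∀ j, AEMeasurable (fun θ => ENNReal.ofReal (ρ j * amplitude (ψ j) θ)) μ₀ := fun j =>
    ((integrable_amplitude (memLp_circleLift_of_lipschitz (hK j))).aemeasurable.const_mul
      (ρ j)).ennreal_ofReal
  have meas' : ∀ j, AEMeasurable (fun θ => ENNReal.ofReal (ρ j * amplitude (deriv (ψ j)) θ)) μ₀ :=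
    fun j => ((integrable_amplitude
      (memLp_circleLift_deriv_of_lipschitz (hK j))).aemeasurable.const_mul (ρ j)).ennreal_ofReal
  have hma : AEMeasurable a μ₀ := AEMeasurable.tsum meas
  have hma' : AEMeasurable a' μ₀ := AEMeasurable.tsum meas'
  -- The integrals against harmonic measure and against arc length take at most half of `T` each.
  have hM1 : (1 : ℝ) ≤ max 1 (r : ℝ)⁻¹ := le_max_left _ _
  have hs2 : (1 : ℝ) ≤ √2 := Real.one_le_sqrt.2 (by norm_num)
  have hlM : l ≤ √2 * max 1 (r : ℝ)⁻¹ := by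
    rw [hl, div_eq_mul_inv]
    gcongr
    exact le_max_right _ _
  have hc1 : (1 + l) * 2 ≤ 4 * √2 * max 1 (r : ℝ)⁻¹ + 1 := by nlinarith
  have hc2 : l * 2 ≤ 4 * √2 * max 1 (r : ℝ)⁻¹ := by nlinarith
  have hae : ∀ᵐ θ ∂μ₀, ENNReal.ofReal (1 + l) * a θ + ENNReal.ofReal l * a' θ ≤ T / 2 := by
    filter_upwards [hT] with θ hθ
    rw [ENNReal.le_div_iff_mul_le (by simp) (by simp)]
    refine le_trans ?_ hθ
    have two : (2 : ℝ≥0∞) = ENNReal.ofReal 2 := by simp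
    rw [add_mul, mul_right_comm, mul_right_comm _ (a' θ), two, ← ENNReal.ofReal_mul (by positivity),
      ← ENNReal.ofReal_mul hl0]
    gcongr
  have half1 : ∫⁻ θ, ENNReal.ofReal (1 + l) * a θ + ENNReal.ofReal l * a' θ ∂harmonicMeasure w ≤
      T / 2 := by
    refine (lintegral_mono_ae (hac.ae_le hae)).trans ?_
    simp
  have half2 : ∫⁻ θ, ENNReal.ofReal l * a θ ∂μ₀ ≤ T / 2 := by
    refine (lintegral_mono_ae (g := fun _ => T / 2) ?_).trans (by simp)
    filter_upwards [hae] with θ hθ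
    refine le_trans ?_ hθ
    refine le_trans ?_ le_self_add
    gcongr
    linarith
  calc ∑' j, ENNReal.ofReal (ρ j * b r (Φ j) (scaledPlane r w))
      ≤ ∑' j, (ENNReal.ofReal (1 + l) *
          ∫⁻ t, ENNReal.ofReal (ρ j * amplitude (ψ j) t) ∂harmonicMeasure w +
        ENNReal.ofReal l *
          ∫⁻ t, ENNReal.ofReal (ρ j * amplitude (deriv (ψ j)) t) ∂harmonicMeasure w +
        ENNReal.ofReal l * ∫⁻ t, ENNReal.ofReal (ρ j * amplitude (ψ j) t) ∂μ₀) :=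
        ENNReal.tsum_le_tsum fun j => ofReal_mul_b_le hr (hK j) (hper j) (hΦ j) hw (hρ j).le
    _ = (∫⁻ θ, ENNReal.ofReal (1 + l) * a θ + ENNReal.ofReal l * a' θ ∂harmonicMeasure w) +
        ∫⁻ θ, ENNReal.ofReal l * a θ ∂μ₀ := by
        rw [ENNReal.tsum_add, ENNReal.tsum_add, ENNReal.tsum_mul_left, ENNReal.tsum_mul_left,
          ENNReal.tsum_mul_left, ← lintegral_tsum fun j => (meas j).mono_ac hac,
          ← lintegral_tsum fun j => (meas' j).mono_ac hac, ← lintegral_tsum meas,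
          lintegral_add_left' ((hma.mono_ac hac).const_mul _),
          lintegral_const_mul'' _ (hma.mono_ac hac), lintegral_const_mul'' _ (hma'.mono_ac hac),
          lintegral_const_mul'' _ hma]
    _ ≤ T / 2 + T / 2 := add_le_add half1 half2
    _ = T := ENNReal.add_halves T

/-- A bound valid in the open disc extends to the boundary, through finite partial sums. -/
theorem tsum_b_le_of_forall_interior (hr : 0 < (r : ℝ))
    (hΦ : ∀ j, IsHarmonicPartialMap r (ψ j) (Φ j)) (hρ : ∀ j, 0 < ρ j) {T : ℝ≥0∞}
    (hT : ∀ w : ℂ, ‖w‖ < 1 → ∑' j, ENNReal.ofReal (ρ j * b r (Φ j) (scaledPlane r w)) ≤ T)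
    {z : ℂ} (hz : ‖z‖ = 1) :
    ∑' j, ENNReal.ofReal (ρ j * b r (Φ j) (scaledPlane r z)) ≤ T := by
  choose l hl hlb using fun j => exists_tendsto_radial_le_b hr (hΦ j) hz
  refine ENNReal.tsum_le_of_sum_range_le fun N => ?_
  have hlim : Tendsto (fun t => ∑ j ∈ Finset.range N, ENNReal.ofReal (ρ j * l j t)) (𝓝[<] 1)
      (𝓝 (∑ j ∈ Finset.range N, ENNReal.ofReal (ρ j * b r (Φ j) (scaledPlane r z)))) :=
    tendsto_finsetSum _ fun j _ => ENNReal.tendsto_ofReal ((hl j).const_mul (ρ j))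
  refine le_of_tendsto hlim ?_
  filter_upwards [(Finset.range N).eventually_all.2 fun j _ => hlb j,
    Ioo_mem_nhdsLT (zero_lt_one' ℝ)] with t ht h01
  have hw : ‖t • z‖ < 1 := by
    rw [norm_smul, hz, mul_one, Real.norm_of_nonneg h01.1.le]
    exact h01.2
  refine le_trans ?_ ((ENNReal.sum_le_tsum (Finset.range N)).trans (hT _ hw))
  refine Finset.sum_le_sum fun j hj => ENNReal.ofReal_le_ofReal ?_
  exact mul_le_mul_of_nonneg_left (ht j hj) (hρ j).le

end series

end Summation

end HarmonicMapping

theorem mainTheorem5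
    (r₀ : ℝ) (hr₀ : 0 < r₀)
    (ψ : ℕ → ℝ → ℝ)
    (hψ_per : ∀ j, Function.Periodic (ψ j) (2 * π))
    (hψ_lip : ∀ j, ∃ K, LipschitzWith K (ψ j))
    (Φ : ℕ → HarmonicMapping.Plane → HarmonicMapping.Plane)
    (hΦ : ∀ j, HarmonicMapping.IsHarmonicPartialMap r₀ (ψ j) (Φ j))
    (ρ : ℕ → ℝ) (hρ : ∀ j, 0 < ρ j) :
    (⨆ x ∈ HarmonicMapping.disc r₀,
        ∑' j, ENNReal.ofReal (ρ j * HarmonicMapping.b r₀ (Φ j) x)) ≤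
      essSup (fun θ : HarmonicMapping.Circle2Pi =>
        ENNReal.ofReal (4 * √2 * max 1 r₀⁻¹ + 1) *
            ∑' j, ENNReal.ofReal (ρ j * HarmonicMapping.amplitude (ψ j) θ) +
          ENNReal.ofReal (4 * √2 * max 1 r₀⁻¹) *
            ∑' j, ENNReal.ofReal (ρ j * HarmonicMapping.amplitude (deriv (ψ j)) θ))
        AddCircle.haarAddCircle := by
  lift r₀ to ℝˣ using hr₀.ne'.isUnit with r
  have hint := fun w (hw : ‖w‖ < 1) =>
    HarmonicMapping.tsum_b_le_of_ae_le hr₀ hψ_per hψ_lip hΦ hρ (ENNReal.ae_le_essSup _) hw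
  refine iSup₂_le fun x hx => ?_
  obtain ⟨z, rfl⟩ := (HarmonicMapping.scaledPlane r).surjective x
  have hz : z ∈ HarmonicMapping.scaledPlane r ⁻¹' HarmonicMapping.disc r := hx
  rw [HarmonicMapping.scaledPlane_preimage_disc hr₀, mem_closedBall_zero_iff] at hz
  rcases hz.lt_or_eq with h | h
  · exact hint z h
  · exact HarmonicMapping.tsum_b_le_of_forall_interior hr₀ hΦ hρ hint h
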